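/- Let $\mathsf{FI}$ be the category whose objects are the sets $\mathbf n=\{1,\dots,n\}$, $n\ge 0$, and whose morphisms are the injections. An $\mathsf{FI}$-module (over $\mathbb Z$) is a functor $F:\mathsf{FI}\to\mathsf{Ab}$, $\mathbf n\mapsto F_n$; kernels and cokernels of morphisms of $\mathsf{FI}$-modules are computed pointwise. For $n\ge 0$ let $P^n$ be the $\mathsf{FI}$-module that sends $\mathbf m$ to the free abelian group on the set $\mathsf{FI}(\mathbf n,\mathbf m)$. An $\mathsf{FI}$-module $F$ is finitely generated if there is a surjection $\bigoplus_{i\in I}P^{n_i}\twoheadrightarrow F$ with $I$ a finite set. Let $R:\mathsf{FI}\to\mathsf{FI}$ be the functor that sends $\mathbf n$ to $\mathbf{1+n}$ and an injection $f:\mathbf n\to\mathbf m$ to the injection $\mathbf{1+n}\to\mathbf{1+m}$ given by $1\mapsto 1$ and $1+i\mapsto 1+f(i)$, and let $\rho:\mathrm{Id}\Rightarrow R$ be the natural transformation with components $\mathbf n\to\mathbf{1+n}$, $i\mapsto 1+i$. For an $\mathsf{FI}$-module $F$, let $\operatorname{Ker}F$ and $\operatorname{Coker}F$ be the kernel and the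 cokernel of the morphism $F\rho:F\to F\circ R$. We say that $F$ has degree $-1$ if $F_n=0$ for all sufficiently large $n$, and, recursively for integers $d\ge 0$, that $F$ has degree $d$ if $\operatorname{Ker}F$ has degree $-1$ and $\operatorname{Coker}F$ has degree $d-1$. Finally, $F$ has finite degree if it has degree $d$ for some integer $d\ge -1$. **Corollary.** Every finitely generated $\mathsf{FI}$-module has finite degree. -/

import Mathlib

open CategoryTheory CategoryTheory.Limits

universe u

/-- The objects of the category `FI`: the object with `card = n` stands for the finite set
`{1, …, n}`, here `Fin n`. -/
@[ext]
structure FI : Type where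
  card : ℕ

namespace FI

/-- The category of the finite sets `{1, …, n}`, `n ≥ 0`, and injections. -/
instance : SmallCategory FI where
  Hom a b := Fin a.card ↪ Fin b.card
  id a := Function.Embedding.refl (Fin a.card)
  comp f g := Function.Embedding.trans f g

/-- The monoidal product `f ⊔ g : n + k → m + l` of injections `f : n → m` and `g : k → l`:
it is `f` on the first `n` elements and `g`, shifted by `m`, on the last `k` elements. -/
def sumMap {n m k l : ℕ} (f : Fin n ↪ Fin m) (g : Fin k ↪ Fin l) :
    Fin (n + k) ↪ Fin (m + l) :=
  (finSumFinEquiv.symm.toEmbedding.trans (f.sumMap g)).trans finSumFinEquiv.toEmbedding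

theorem sumMap_castAdd {n m k l : ℕ} (f : Fin n ↪ Fin m) (g : Fin k ↪ Fin l) (i : Fin n) :
    sumMap f g (Fin.castAdd k i) = Fin.castAdd l (f i) := by
  simp [sumMap]

theorem sumMap_natAdd {n m k l : ℕ} (f : Fin n ↪ Fin m) (g : Fin k ↪ Fin l) (i : Fin k) :
    sumMap f g (Fin.natAdd n i) = Fin.natAdd m (g i) := by
  simp [sumMap]

/-- The functor `R = 1 ⊔ (-) : FI ⥤ FI`. -/
def shift : FI ⥤ FI where
  obj a := ⟨1 + a.card⟩
  map {a b} f := (sumMap (Function.Embedding.refl (Fin 1)) f : Fin (1 + a.card) ↪ Fin (1 + b.card))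
  map_id a := by
    refine DFunLike.ext (F := Fin (1 + a.card) ↪ Fin (1 + a.card)) _ _ fun i => ?_
    induction i using Fin.addCases with
    | left i => exact sumMap_castAdd _ _ i
    | right i => exact sumMap_natAdd _ _ i
  map_comp {a b c} f g := by
    refine DFunLike.ext (F := Fin (1 + a.card) ↪ Fin (1 + c.card)) _ _ fun i => ?_
    induction i using Fin.addCases with
    | left i =>
      refine (sumMap_castAdd _ _ i).trans ?_
      refine Eq.trans ?_ (congrArg (sumMap _ g) (sumMap_castAdd _ f i)).symm
      exact (sumMap_castAdd _ g i).symm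
    | right i =>
      refine (sumMap_natAdd _ _ i).trans ?_
      refine Eq.trans ?_ (congrArg (sumMap _ g) (sumMap_natAdd _ f i)).symm
      exact (sumMap_natAdd _ g (Function.Embedding.toFun (α := Fin a.card) (β := Fin b.card) f i)).symm

/-- The natural transformation `ρ : Id ⟶ R` induced by the unique arrow `0 → 1`. Its component
at `n` is `(0 → 1) ⊔ id : n = 0 + n → 1 + n`, which sends the `i`-th element to the
`(1 + i)`-th one. -/
def toShift : 𝟭 FI ⟶ shift where
  app a := (Fin.natAddEmb 1 : Fin a.card ↪ Fin (1 + a.card))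
  naturality a b f := by
    refine DFunLike.ext (F := Fin a.card ↪ Fin (1 + b.card)) _ _ fun i => ?_
    exact (sumMap_natAdd _ f i).symm

end FI

/-- An `FI`-module (over `ℤ`): a functor from `FI` to abelian groups. -/
abbrev FIModule := FI ⥤ AddCommGrpCat.{u}

namespace FIModule

/-- The suspension `Σ F = F ∘ R`. -/
abbrev suspension (F : FIModule.{u}) : FIModule.{u} := FI.shift ⋙ F

/-- The morphism `F ρ : F ⟶ Σ F`. -/
def toSuspension (F : FIModule.{u}) : F ⟶ F.suspension where
  app a := F.map (FI.toShift.app a)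
  naturality a b f := by
    have h := congrArg F.map (FI.toShift.naturality f)
    rw [F.map_comp, F.map_comp] at h
    exact h

/-- `Ker F`, the kernel of `F ρ : F ⟶ Σ F` in the abelian category of `FI`-modules. -/
noncomputable def Ker (F : FIModule.{u}) : FIModule.{u} := kernel F.toSuspension

/-- `Coker F`, the cokernel of `F ρ : F ⟶ Σ F` in the abelian category of `FI`-modules. -/
noncomputable def Coker (F : FIModule.{u}) : FIModule.{u} := cokernel F.toSuspension

/-- `F.HasDegree d`: the `FI`-module `F` has degree `d`, where `d ≥ -1` is an integer. -/
inductive HasDegree : FIModule.{u} → ℤ → Prop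
  | neg_one (F : FIModule.{u}) (h : ∃ N : ℕ, ∀ n : ℕ, N ≤ n → Subsingleton (F.obj ⟨n⟩)) :
      HasDegree F (-1)
  | nonneg (F : FIModule.{u}) (d : ℤ) (hd : 0 ≤ d) (hker : HasDegree F.Ker (-1))
      (hcoker : HasDegree F.Coker (d - 1)) : HasDegree F d

/-- `F` has finite degree if it has degree `d` for some `d ≥ -1`. -/
def HasFiniteDegree (F : FIModule.{u}) : Prop := ∃ d : ℤ, -1 ≤ d ∧ F.HasDegree d

/-- The principal projective `P^n`, which sends `m` to the free abelian group on the set of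
injections from `{1, …, n}` to `{1, …, m}` (lifted to the universe `u`). -/
def principal (n : ℕ) : FIModule.{u} :=
  coyoneda.obj (Opposite.op (FI.mk n)) ⋙ uliftFunctor.{u, 0} ⋙ AddCommGrpCat.free.{u}

/-- `F` is finitely generated if there is a surjection from a finite direct sum of principal
projectives onto `F`. -/
def IsFinitelyGenerated (F : FIModule.{u}) : Prop :=
  ∃ (I : Type) (_ : Finite I) (n : I → ℕ) (φ : (∐ fun i => principal.{u} (n i)) ⟶ F),
    ∀ a : FI, Function.Surjective (φ.app a)

end FIModule

/-!
Let `F` be generated by finitely many elements `x i` of degrees `n i`. The theorem follows by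
induction on a bound for the `n i` from two facts.

* `Coker F` is again finitely generated, by elements of degrees `n i - 1`
  (`FIModule.Generates.coker`). Indeed an injection `g` into `1 + m` either misses the first point,
  and then `F(g)` takes its values in the image of `F ρ`, or it is `R(k)` precomposed with a
  bijection, for an injection `k` of sets with one point less.
* `Ker F` vanishes in large degrees (`FIModule.Generates.exists_torsion_eq_bot`).

The second fact is where the Noetherian property of `ℤ` enters. The group `F_m` is spanned by the
vectors `F(g) (x i)`, which are indexed by the cells `(i, g)`. In the lexicographic order of the
cells, postcomposition with an order preserving injection is strictly increasing
(`Cell.push_strictMono`), so it respects the filtration of `F_m` by the spans of initial segments.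
To a cell `s` belongs the ideal `FIModule.leadingIdeal` of those integers `c` for which `c` times
the vector of `s` is, modulo lower terms, in `Ker F`; it grows when `s` is pushed forward along an
order preserving injection. By Dickson's lemma the injections `Fin d ↪ Fin m`, for varying `m`, are
well-quasi-ordered by such push-forwards, and ascending chains of ideals are stationary; hence
every cell of large degree is the push-forward of a cell of bounded degree with the same leading
ideal (`exists_bound_of_monotone_ideal`). A proper push-forward kills `Ker F`. So an element of
`Ker F` of large degree whose leading term is in the cell `s` can be rewritten with lower terms
only, and by descent along the finite set of cells it is zero.
-/

/-! ### Injections between finite ordinals and Dickson's lemma -/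

/-- An injection `g'` factors through `g` by an order preserving map as soon as no gap between two
values of `g`, or between a value of `g` and one of the two ends, is larger than the corresponding
gap for `g'`. Subtraction is truncated, so `hgap` only speaks of `a`, `b` with `g a < g b`; in
particular it forces `g'` to have its values in the same relative order. The map constructed moves
each point by the displacement of the next value of `g` above it. -/
theorem exists_strictMono_comp_eq {d m m' : ℕ} (g : Fin d ↪ Fin m) (g' : Fin d ↪ Fin m')
    (hm : m ≤ m') (hle : ∀ a, (g a : ℕ) ≤ g' a)
    (hgap : ∀ a b, (g b : ℕ) - g a ≤ g' b - g' a)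
    (hend : ∀ a, m - (g a : ℕ) ≤ m' - g' a) :
    ∃ h : Fin m ↪ Fin m', StrictMono h ∧ ∀ a, h (g a) = g' a := by
  classical
  -- `δ a` is the displacement of the point `a`; the value at `none` is that of the endpoint.
  let v : Option (Fin d) → ℕ := fun o => o.elim m fun a => g a
  let δ : Option (Fin d) → ℕ := fun o => o.elim (m' - m) fun a => g' a - g a
  have hδ : ∀ a b, v a ≤ v b → δ a ≤ δ b := by
    rintro (_ | a) (_ | b) hab
    · rfl
    · have := (g b).isLt
      simp only [v, Option.elim] at hab
      omega
    · have := hend a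
      have := (g a).isLt
      have := (g' a).isLt
      simp only [δ, Option.elim]
      omega
    · simp only [v, Option.elim] at hab
      simp only [δ, Option.elim]
      rcases hab.eq_or_lt with hab | hab
      · rw [g.injective (Fin.ext hab)]
      · have := hgap a b
        have := hle a
        omega
  let T : Fin m → Finset (Option (Fin d)) := fun x => Finset.univ.filter fun o => (x : ℕ) ≤ v o
  have hT : ∀ x, (T x).Nonempty := fun x => ⟨none, by simp [T, v, x.isLt.le]⟩
  have hend' : ∀ x, (T x).inf' (hT x) δ ≤ m' - m := fun x =>
    Finset.inf'_le δ (show none ∈ T x by simp [T, v, x.isLt.le])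
  have hlt : ∀ x : Fin m, (x : ℕ) + (T x).inf' (hT x) δ < m' := fun x => by
    have := hend' x
    have := x.isLt
    omega
  let h : Fin m → Fin m' := fun x => ⟨x + (T x).inf' (hT x) δ, hlt x⟩
  have hmono : StrictMono h := by
    intro x y hxy
    have : (T x).inf' (hT x) δ ≤ (T y).inf' (hT y) δ := by
      refine Finset.inf'_mono δ (fun o ho => ?_) (hT y)
      simp only [T, Finset.mem_filter, Finset.mem_univ, true_and] at ho ⊢
      have : (x : ℕ) < y := hxy
      omega
    exact Fin.lt_def.2 (Nat.add_lt_add_of_lt_of_le hxy this)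
  refine ⟨⟨h, hmono.injective⟩, hmono, fun a => Fin.ext ?_⟩
  have : (T (g a)).inf' (hT (g a)) δ = δ (some a) := by
    refine le_antisymm (Finset.inf'_le δ (by simp [T, v])) (Finset.le_inf' _ _ fun o ho => ?_)
    simp only [T, Finset.mem_filter, Finset.mem_univ, true_and] at ho
    exact hδ (some a) o ho
  have hle' := hle a
  change (g a : ℕ) + (T (g a)).inf' (hT (g a)) δ = g' a
  rw [this]
  simp only [δ, Option.elim]
  omega

/-- A family of ideals indexed by the injections from a fixed `Fin d` and growing along order
preserving maps is determined by its members in bounded degree. -/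
theorem exists_bound_of_monotone_ideal {d : ℕ} {R : Type*} [CommRing R] [IsNoetherianRing R]
    (J : ∀ m, (Fin d ↪ Fin m) → Ideal R)
    (hJ : ∀ (m m' : ℕ) (g : Fin d ↪ Fin m) (h : Fin m ↪ Fin m'), StrictMono h →
      J m g ≤ J m' (g.trans h)) :
    ∃ N, ∀ (m : ℕ) (g : Fin d ↪ Fin m), ∃ (m₀ : ℕ) (g₀ : Fin d ↪ Fin m₀) (h : Fin m₀ ↪ Fin m),
      m₀ ≤ N ∧ StrictMono h ∧ g₀.trans h = g ∧ J m g ≤ J m₀ g₀ := by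
  by_contra! hbad
  choose m g hg using hbad
  -- Domination of these tuples of natural numbers amounts to factoring through an order
  -- embedding.
  let E : ℕ → ℕ × (Fin d → ℕ) × (Fin d → ℕ) × (Fin d × Fin d → ℕ) := fun k =>
    (m k, fun a => g k a, fun a => m k - g k a, fun p => g k p.2 - g k p.1)
  obtain ⟨φ, hφ⟩ := (wellQuasiOrdered_le
    (α := ℕ × (Fin d → ℕ) × (Fin d → ℕ) × (Fin d × Fin d → ℕ))).exists_monotone_subseq E
  have key : ∀ k l, k ≤ l → ∃ h : Fin (m (φ k)) ↪ Fin (m (φ l)), StrictMono h ∧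
      (g (φ k)).trans h = g (φ l) := by
    intro k l hkl
    have hE := hφ k l hkl
    obtain ⟨h, h1, h2⟩ := exists_strictMono_comp_eq (g (φ k)) (g (φ l)) hE.1
      (fun a => hE.2.1 a) (fun a b => hE.2.2.2 (a, b)) (fun a => hE.2.2.1 a)
    exact ⟨h, h1, DFunLike.ext _ _ h2⟩
  have hmono : Monotone fun k => J (m (φ k)) (g (φ k)) := by
    intro k l hkl
    obtain ⟨h, h1, h2⟩ := key k l hkl
    have := hJ _ _ (g (φ k)) h h1
    rwa [h2] at this
  obtain ⟨k, hk⟩ := WellFoundedGT.monotone_chain_condition (⟨_, hmono⟩ : ℕ →o Ideal R)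
  obtain ⟨l, hkl, hl⟩ : ∃ l, k ≤ l ∧ m (φ k) ≤ φ l :=
    ⟨max k (m (φ k)), le_max_left _ _, (le_max_right _ _).trans φ.strictMono.le_apply⟩
  obtain ⟨h, h1, h2⟩ := key k l hkl
  exact hg (φ l) _ (g (φ k)) h hl h1 h2 (hk l hkl).ge

/-! ### Descent along a finite filtration -/

/-- If membership of `x` in a step of the filtration by spans of initial segments always improves
to membership in the previous step, then `x` is zero. -/
theorem eq_zero_of_forall_mem_span_Iio {R M ι : Type*} [Semiring R] [AddCommMonoid M] [Module R M]
    [LinearOrder ι] [Finite ι] (e : ι → M) (he : Submodule.span R (Set.range e) = ⊤) (x : M)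
    (hx : ∀ s, x ∈ Submodule.span R (e '' Set.Iic s) → x ∈ Submodule.span R (e '' Set.Iio s)) :
    x = 0 := by
  have hIic : ∀ s, x ∈ Submodule.span R (e '' Set.Iic s) → x = 0 := by
    intro s
    induction s using WellFoundedLT.induction with
    | ind s ih =>
      intro hs
      have hs := hx s hs
      rcases (Set.Iio s).eq_empty_or_nonempty with h0 | h0
      · simpa [h0] using hs
      · obtain ⟨t, ht, hmax⟩ := Set.exists_max_image (Set.Iio s) id (Set.toFinite _) h0
        exact ih t ht (Submodule.span_mono (Set.image_mono fun r hr => hmax r hr) hs)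
  have hmem : x ∈ Submodule.span R (Set.range e) := he ▸ Submodule.mem_top
  rcases isEmpty_or_nonempty ι with h0 | h0
  · simpa [Set.range_eq_empty] using hmem
  · obtain ⟨t, hmax⟩ := Finite.exists_max (id : ι → ι)
    refine hIic t (Submodule.span_mono ?_ hmem)
    rintro _ ⟨r, rfl⟩
    exact ⟨r, hmax r, rfl⟩

/-! ### The ordered set of cells -/

/-- Pairs of an index `i : I` and an injection from `{1, …, n i}` to `{1, …, m}`. They index the
evident spanning family of the value at `m` of an `FI`-module with generators of degrees `n i`. -/
def Cell {I : Type*} (n : I → ℕ) (m : ℕ) : Type _ := Σ i, Fin (n i) ↪ Fin m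

namespace Cell

variable {I : Type*} {n : I → ℕ} {m m' : ℕ}

instance [Finite I] : Finite (Cell n m) := inferInstanceAs (Finite (Σ i, Fin (n i) ↪ Fin m))

/-- A pair in `Cell n m`, seen in the lexicographic sum of the lexicographically ordered sets of
maps from `{1, …, n i}` to `{1, …, m}`. -/
def toLexSigma (s : Cell n m) : Σₗ i, Lex (Fin (n i) → Fin m) := toLex ⟨s.1, toLex s.2⟩

theorem toLexSigma_injective : Function.Injective (toLexSigma (n := n) (m := m)) := by
  rintro ⟨i, g⟩ ⟨j, g'⟩ h
  have h' : (⟨i, toLex g⟩ : Σ i, Lex (Fin (n i) → Fin m)) = ⟨j, toLex g'⟩ := h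
  obtain ⟨rfl, h2⟩ := Sigma.mk.inj_iff.1 h'
  have h3 : (g : Fin (n i) → Fin m) = g' := eq_of_heq h2
  rw [DFunLike.coe_injective h3]

/-- The order by index, then lexicographic in the values of the injection. -/
noncomputable instance [LinearOrder I] : LinearOrder (Cell n m) :=
  LinearOrder.lift' toLexSigma toLexSigma_injective

/-- Composition of the injection in a cell with a further injection. -/
def push (h : Fin m ↪ Fin m') (s : Cell n m) : Cell n m' := ⟨s.1, s.2.trans h⟩

theorem push_strictMono [LinearOrder I] {h : Fin m ↪ Fin m'} (hh : StrictMono h) :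
    StrictMono (push (n := n) h) := by
  rintro ⟨i, g⟩ ⟨j, g'⟩ hlt
  have hlt : Sigma.Lex (· < ·) (fun i (a b : Lex (Fin (n i) → Fin m)) => a < b)
    ⟨i, toLex g⟩ ⟨j, toLex g'⟩ := hlt
  change Sigma.Lex (· < ·) (fun i (a b : Lex (Fin (n i) → Fin m')) => a < b)
    ⟨i, toLex (g.trans h)⟩ ⟨j, toLex (g'.trans h)⟩
  rw [Sigma.lex_iff] at hlt ⊢
  rcases hlt with hlt | ⟨hij, hlt⟩
  · exact Or.inl hlt
  · dsimp only at hij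
    subst hij
    obtain ⟨a, h1, h2⟩ := hlt
    exact Or.inr ⟨rfl, a, fun b hb => congrArg h (h1 b hb), hh h2⟩

end Cell

/-! ### Injections and the functor `R` -/

namespace FI

/-- An injection, as a morphism of `FI`. -/
def homOfEmb {a b : ℕ} (g : Fin a ↪ Fin b) : FI.mk a ⟶ FI.mk b := g

theorem homOfEmb_trans {a b c : ℕ} (g : Fin a ↪ Fin b) (h : Fin b ↪ Fin c) :
    homOfEmb (g.trans h) = homOfEmb g ≫ homOfEmb h := rfl

/-- An injection `m → m'` with `m < m'` misses a point, which can serve as the image of the point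
added by `ρ`. -/
theorem exists_natAddEmb_trans_eq {m m' : ℕ} (hm : m < m') (h : Fin m ↪ Fin m') :
    ∃ k : Fin (1 + m) ↪ Fin m', (Fin.natAddEmb 1).trans k = h := by
  obtain ⟨y, hy⟩ : ∃ y, ∀ x, h x ≠ y := by
    by_contra! hsurj
    have := Fintype.card_le_of_surjective h hsurj
    simp only [Fintype.card_fin] at this
    omega
  refine ⟨⟨Fin.addCases (fun _ => y) h, ?_⟩, ?_⟩
  · intro a b hab
    induction a using Fin.addCases <;> induction b using Fin.addCases <;> simp_all
    exact Subsingleton.elim _ _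
  · refine DFunLike.ext _ _ fun x => ?_
    exact Fin.addCases_right (motive := fun _ => Fin m') (left := fun _ => y) (right := h) x

/-- An injection into `1 + m` that misses the first point comes from an injection into `m`. -/
theorem exists_trans_natAddEmb_eq {a m : ℕ} (g : Fin a ↪ Fin (1 + m))
    (hg : ∀ j, g j ≠ Fin.castAdd m 0) :
    ∃ k : Fin a ↪ Fin m, k.trans (Fin.natAddEmb 1) = g := by
  have : ∀ j, ∃ i, Fin.natAdd 1 i = g j := by
    intro j
    generalize hx : g j = x
    induction x using Fin.addCases with
    | left i => exact absurd (by rw [hx, Subsingleton.elim i 0]) (hg j)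
    | right i => exact ⟨i, rfl⟩
  choose k hk using this
  refine ⟨⟨k, fun x y hxy => g.injective ?_⟩, DFunLike.ext _ _ hk⟩
  rw [← hk, ← hk, hxy]

/-- A bijection from `{1, …, a}` to `{1, …, 1 + (a - 1)}` that sends `j` to the first point. -/
noncomputable def moveFirst {a : ℕ} (j : Fin a) : Fin a ≃ Fin (1 + (a - 1)) :=
  (finCongr (by have := j.isLt; omega)).trans (Equiv.swap (finCongr (by have := j.isLt; omega) j)
    (Fin.castAdd (a - 1) 0))

theorem moveFirst_self {a : ℕ} (j : Fin a) : moveFirst j j = Fin.castAdd (a - 1) 0 := by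
  simp [moveFirst]

/-- An injection into `1 + m` that hits the first point is, up to a bijection of its source, in
the image of `R`. -/
theorem exists_moveFirst_trans_eq {a m : ℕ} (g : Fin a ↪ Fin (1 + m)) (j : Fin a)
    (hg : g j = Fin.castAdd m 0) :
    ∃ k : Fin (a - 1) ↪ Fin m, (moveFirst j).toEmbedding.trans
      (sumMap (Function.Embedding.refl (Fin 1)) k) = g := by
  obtain ⟨k, hk⟩ := exists_trans_natAddEmb_eq
    ((Fin.natAddEmb 1).trans ((moveFirst j).symm.toEmbedding.trans g)) (fun i hi => by
      have hi' : g ((moveFirst j).symm (Fin.natAdd 1 i)) = Fin.castAdd m 0 := hi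
      rw [← hg] at hi'
      have := g.injective hi'
      rw [Equiv.symm_apply_eq, moveFirst_self] at this
      have := congrArg Fin.val this
      simp at this)
  refine ⟨k, DFunLike.ext _ _ fun x => ?_⟩
  obtain ⟨y, rfl⟩ := (moveFirst j).symm.surjective x
  change sumMap _ k (moveFirst j ((moveFirst j).symm y)) = _
  rw [Equiv.apply_symm_apply]
  induction y using Fin.addCases with
  | left i =>
    rw [Subsingleton.elim i 0, ← moveFirst_self j, Equiv.symm_apply_apply, hg, moveFirst_self]
    exact sumMap_castAdd _ _ _
  | right i => exact (sumMap_natAdd _ _ _).trans (DFunLike.congr_fun hk i)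

end FI

/-! ### Generators and torsion -/

namespace FIModule

variable {I : Type*} {n : I → ℕ}

/-- The map `F_a → F_b` induced by an injection, as a `ℤ`-linear map. -/
def act (F : FIModule.{u}) {a b : ℕ} (g : Fin a ↪ Fin b) : F.obj ⟨a⟩ →ₗ[ℤ] F.obj ⟨b⟩ :=
  (F.map (FI.homOfEmb g)).hom.toIntLinearMap

theorem act_trans (F : FIModule.{u}) {a b c : ℕ} (g : Fin a ↪ Fin b) (h : Fin b ↪ Fin c)
    (x : F.obj ⟨a⟩) : F.act (g.trans h) x = F.act h (F.act g x) := by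
  simp [act, FI.homOfEmb_trans]

/-- The image `F(g) x_i` of the generator `x_i` in the cell `(i, g)`. -/
def cellVec (F : FIModule.{u}) (x : ∀ i, F.obj ⟨n i⟩) {m : ℕ} (s : Cell n m) : F.obj ⟨m⟩ :=
  F.act s.2 (x s.1)

theorem act_cellVec (F : FIModule.{u}) (x : ∀ i, F.obj ⟨n i⟩) {m m' : ℕ} (h : Fin m ↪ Fin m')
    (s : Cell n m) : F.act h (F.cellVec x s) = F.cellVec x (s.push h) :=
  (F.act_trans s.2 h (x s.1)).symm

/-- The elements `x_i` of degrees `n i` generate `F`. -/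
def Generates (F : FIModule.{u}) (x : ∀ i, F.obj ⟨n i⟩) : Prop :=
  ∀ m, Submodule.span ℤ (Set.range (F.cellVec x (m := m))) = ⊤

/-- The elements of `F_m` that are killed by `F ρ`. -/
def torsion (F : FIModule.{u}) (m : ℕ) : Submodule ℤ (F.obj ⟨m⟩) :=
  LinearMap.ker (F.act (Fin.natAddEmb 1))

theorem act_eq_zero_of_mem_torsion (F : FIModule.{u}) {m m' : ℕ} (hm : m < m')
    (h : Fin m ↪ Fin m') {y : F.obj ⟨m⟩} (hy : y ∈ F.torsion m) : F.act h y = 0 := by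
  obtain ⟨k, rfl⟩ := FI.exists_natAddEmb_trans_eq hm h
  rw [act_trans, LinearMap.mem_ker.1 hy, map_zero]

theorem act_mem_torsion (F : FIModule.{u}) {m m' : ℕ} (h : Fin m ↪ Fin m') {y : F.obj ⟨m⟩}
    (hy : y ∈ F.torsion m) : F.act h y ∈ F.torsion m' := by
  have hm : m ≤ m' := by simpa using Fintype.card_le_of_embedding h
  rw [torsion, LinearMap.mem_ker, ← act_trans]
  exact F.act_eq_zero_of_mem_torsion (by omega) _ hy

/-! ### Leading ideals of the torsion -/

section Filtration

variable [LinearOrder I] (F : FIModule.{u}) (x : ∀ i, F.obj ⟨n i⟩) {m m' : ℕ}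

/-- The span of the images of the generators in the cells below `s`. -/
def below (s : Cell n m) : Submodule ℤ (F.obj ⟨m⟩) :=
  Submodule.span ℤ (F.cellVec x '' Set.Iio s)

theorem act_mem_below {h : Fin m ↪ Fin m'} (hh : StrictMono h) (s : Cell n m) {y : F.obj ⟨m⟩}
    (hy : y ∈ F.below x s) : F.act h y ∈ F.below x (s.push h) := by
  have : F.below x s ≤ (F.below x (s.push h)).comap (F.act h) := by
    refine Submodule.span_le.2 ?_
    rintro _ ⟨t, ht, rfl⟩
    refine Submodule.subset_span ⟨t.push h, Cell.push_strictMono hh ht, ?_⟩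
    exact (F.act_cellVec x h t).symm
  exact this hy

/-- The ideal of the integers `c` for which `c` times the vector in the cell `s` is the leading
term of a torsion element. -/
def leadingIdeal (s : Cell n m) : Ideal ℤ :=
  (F.torsion m ⊔ F.below x s).comap (LinearMap.toSpanSingleton ℤ (F.obj ⟨m⟩) (F.cellVec x s))

theorem mem_leadingIdeal {s : Cell n m} {c : ℤ} : c ∈ F.leadingIdeal x s ↔
    ∃ y ∈ F.torsion m, ∃ z ∈ F.below x s, y + z = c • F.cellVec x s := by
  rw [leadingIdeal, Submodule.mem_comap, Submodule.mem_sup]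
  rfl

theorem leadingIdeal_le_push {h : Fin m ↪ Fin m'} (hh : StrictMono h) (s : Cell n m) :
    F.leadingIdeal x s ≤ F.leadingIdeal x (s.push h) := by
  intro c hc
  obtain ⟨y, hy, z, hz, hyz⟩ := (F.mem_leadingIdeal x).1 hc
  refine (F.mem_leadingIdeal x).2
    ⟨_, F.act_mem_torsion h hy, _, F.act_mem_below x hh s hz, ?_⟩
  rw [← map_add, hyz, map_zsmul, act_cellVec]

/-- If a cell is pushed forward from a smaller degree, then the leading ideal of the source
consists of coefficients that can be absorbed into lower terms, because torsion dies. -/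
theorem smul_cellVec_push_mem_below {h : Fin m ↪ Fin m'} (hh : StrictMono h) (hm : m < m')
    (s : Cell n m) {c : ℤ} (hc : c ∈ F.leadingIdeal x s) :
    c • F.cellVec x (s.push h) ∈ F.below x (s.push h) := by
  obtain ⟨y, hy, z, hz, hyz⟩ := (F.mem_leadingIdeal x).1 hc
  have := F.act_mem_below x hh s hz
  rwa [← act_cellVec, ← map_zsmul, ← hyz, map_add, F.act_eq_zero_of_mem_torsion hm h hy, zero_add]

variable {F x}

/-- A torsion element of large degree is killed by rewriting its leading term, which lies in a cell
pushed forward from a smaller degree with the same leading ideal. -/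
theorem Generates.exists_torsion_eq_bot [Finite I] (hx : F.Generates x) :
    ∃ N, ∀ m, N ≤ m → F.torsion m = ⊥ := by
  have key : ∀ i, ∃ N, ∀ (m : ℕ) (g : Fin (n i) ↪ Fin m),
      ∃ (m₀ : ℕ) (g₀ : Fin (n i) ↪ Fin m₀) (h : Fin m₀ ↪ Fin m),
        m₀ ≤ N ∧ StrictMono h ∧ g₀.trans h = g ∧
        F.leadingIdeal x ⟨i, g⟩ ≤ F.leadingIdeal x ⟨i, g₀⟩ := fun i =>
    exists_bound_of_monotone_ideal (fun m g => F.leadingIdeal x ⟨i, g⟩)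
      fun m m' g h hh => F.leadingIdeal_le_push x hh ⟨i, g⟩
  choose N hN using key
  obtain ⟨B, hB⟩ := (Set.finite_range N).bddAbove
  refine ⟨B + 1, fun m hm => (Submodule.eq_bot_iff _).2 fun y hy => ?_⟩
  refine eq_zero_of_forall_mem_span_Iio (F.cellVec x) (hx m) y fun s hs => ?_
  rw [← Set.Iio_insert, Set.image_insert_eq, Submodule.mem_span_insert] at hs
  obtain ⟨c, z, hz, rfl⟩ := hs
  have hc : c ∈ F.leadingIdeal x s :=
    (F.mem_leadingIdeal x).2 ⟨_, hy, -z, Submodule.neg_mem _ hz, by abel⟩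
  obtain ⟨i, g⟩ := s
  obtain ⟨m₀, g₀, h, hm₀, hh, rfl, hle⟩ := hN i m g
  have hm₀B : m₀ < m := by
    have := hB ⟨i, rfl⟩
    omega
  exact Submodule.add_mem _ (F.smul_cellVec_push_mem_below x hh hm₀B ⟨i, g₀⟩ (hle hc)) hz

end Filtration

/-! ### Kernel, cokernel and degree -/

theorem Generates.hasDegree_Ker [LinearOrder I] [Finite I] {F : FIModule.{u}}
    {x : ∀ i, F.obj ⟨n i⟩} (hx : F.Generates x) : F.Ker.HasDegree (-1) := by
  obtain ⟨N, hN⟩ := hx.exists_torsion_eq_bot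
  refine .neg_one _ ⟨N, fun m hm => subsingleton_of_forall_eq 0 fun y => ?_⟩
  let ι : F.Ker ⟶ F := kernel.ι F.toSuspension
  have hmono : Mono (ι.app ⟨m⟩) := by
    have : Mono ι := inferInstanceAs (Mono (kernel.ι F.toSuspension))
    infer_instance
  have hzero : ι ≫ F.toSuspension = 0 := kernel.condition _
  refine (AddCommGrpCat.mono_iff_injective _).1 hmono ?_
  rw [map_zero]
  have : ι.app ⟨m⟩ y ∈ F.torsion m :=
    ConcreteCategory.congr_hom (NatTrans.congr_app hzero ⟨m⟩) y
  rwa [hN m hm, Submodule.mem_bot] at this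

/-- The projection `F_{1 + m} → (Coker F)_m`. -/
noncomputable def cokerProj (F : FIModule.{u}) (m : ℕ) : F.obj ⟨1 + m⟩ →ₗ[ℤ] F.Coker.obj ⟨m⟩ :=
  ((cokernel.π F.toSuspension).app ⟨m⟩).hom.toIntLinearMap

theorem cokerProj_surjective (F : FIModule.{u}) (m : ℕ) : Function.Surjective (F.cokerProj m) :=
  (AddCommGrpCat.epi_iff_surjective ((cokernel.π F.toSuspension).app ⟨m⟩)).1 inferInstance

theorem cokerProj_act_natAddEmb (F : FIModule.{u}) {m : ℕ} (y : F.obj ⟨m⟩) :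
    F.cokerProj m (F.act (Fin.natAddEmb 1) y) = 0 :=
  ConcreteCategory.congr_hom (NatTrans.congr_app (cokernel.condition F.toSuspension) ⟨m⟩) y

theorem cokerProj_act_sumMap (F : FIModule.{u}) {m m' : ℕ} (k : Fin m ↪ Fin m')
    (y : F.obj ⟨1 + m⟩) :
    F.cokerProj m' (F.act (FI.sumMap (Function.Embedding.refl (Fin 1)) k) y) =
      F.Coker.act k (F.cokerProj m y) :=
  ConcreteCategory.congr_hom ((cokernel.π F.toSuspension).naturality (FI.homOfEmb k)) y

/-- Moving one of the `n i` points to the front turns the generator `x_i` into `n i` elements of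
degree `n i - 1` of the cokernel. Together they generate it. -/
theorem Generates.coker {F : FIModule.{u}} {x : ∀ i, F.obj ⟨n i⟩} (hx : F.Generates x) :
    F.Coker.Generates (n := fun p : Σ i, Fin (n i) => n p.1 - 1) fun p =>
      F.cokerProj _ (F.act (FI.moveFirst p.2).toEmbedding (x p.1)) := by
  intro m
  rw [eq_top_iff]
  intro z _
  obtain ⟨y, rfl⟩ := F.cokerProj_surjective m z
  have hy : y ∈ Submodule.span ℤ (Set.range (F.cellVec x (m := 1 + m))) := by
    rw [hx]
    trivial
  induction hy using Submodule.span_induction with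
  | zero => simp
  | add y z _ _ hy hz =>
    rw [map_add]
    exact Submodule.add_mem _ (hy trivial) (hz trivial)
  | smul c y _ hy =>
    rw [map_smul]
    exact Submodule.smul_mem _ c (hy trivial)
  | mem y hy =>
    obtain ⟨⟨i, g⟩, rfl⟩ := hy
    by_cases hg : ∃ j, g j = Fin.castAdd m 0
    · obtain ⟨j, hj⟩ := hg
      obtain ⟨k, rfl⟩ := FI.exists_moveFirst_trans_eq g j hj
      refine Submodule.subset_span ⟨⟨⟨i, j⟩, k⟩, ?_⟩
      simp only [cellVec, act_trans, cokerProj_act_sumMap]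
    · obtain ⟨k, rfl⟩ := FI.exists_trans_natAddEmb_eq g (not_exists.1 hg)
      simp only [cellVec, act_trans, cokerProj_act_natAddEmb]
      exact Submodule.zero_mem _

/-- Each passage to the cokernel lowers the degrees of the generators, so that the degree of `F`
is bounded by these degrees. -/
theorem Generates.hasDegree (D : ℕ) {I : Type} [Finite I] {n : I → ℕ} {F : FIModule.{u}}
    {x : ∀ i, F.obj ⟨n i⟩} (hx : F.Generates x) (hn : ∀ i, n i < D) :
    F.HasDegree ((D : ℤ) - 1) := by
  induction D generalizing I F with
  | zero =>
    have : IsEmpty I := ⟨fun i => Nat.not_lt_zero _ (hn i)⟩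
    refine .neg_one _ ⟨0, fun m _ => ?_⟩
    have h := hx m
    have : IsEmpty (Cell n m) := ⟨fun s => isEmptyElim s.1⟩
    rw [Set.range_eq_empty, Submodule.span_empty] at h
    exact (Submodule.subsingleton_iff ℤ).1 (subsingleton_of_bot_eq_top h)
  | succ D ih =>
    obtain ⟨r, ⟨e⟩⟩ := Finite.exists_equiv_fin I
    let : LinearOrder I := LinearOrder.lift' e e.injective
    rw [Nat.cast_succ, add_sub_cancel_right]
    refine .nonneg _ _ (Int.natCast_nonneg D) hx.hasDegree_Ker (ih hx.coker fun p => ?_)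
    have := hn p.1
    have := p.2.isLt
    change n p.1 - 1 < D
    omega

/-- The quotient of `F_m` by the span of the cell vectors receives the zero map from the coproduct,
which surjects onto `F_m`. -/
theorem IsFinitelyGenerated.exists_generates {F : FIModule.{u}} (hF : F.IsFinitelyGenerated) :
    ∃ (I : Type) (_ : Finite I) (n : I → ℕ) (x : ∀ i, F.obj ⟨n i⟩), F.Generates x := by
  obtain ⟨I, hI, n, φ, hφ⟩ := hF
  let ψ : ∀ i, principal.{u} (n i) ⟶ F := fun i => Sigma.ι (fun i => principal.{u} (n i)) i ≫ φ
  -- The generator `x_i` is the image of the identity of `n i`.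
  let x : ∀ i, F.obj ⟨n i⟩ := fun i =>
    (ψ i).app ⟨n i⟩ (FreeAbelianGroup.of (ULift.up (𝟙 (FI.mk (n i)))))
  have hψ : ∀ i m (g : Fin (n i) ↪ Fin m),
      (ψ i).app ⟨m⟩ (FreeAbelianGroup.of (ULift.up (FI.homOfEmb g))) = F.act g (x i) := by
    intro i m g
    have := ConcreteCategory.congr_hom ((ψ i).naturality (FI.homOfEmb g))
      (FreeAbelianGroup.of (ULift.up (𝟙 (FI.mk (n i)))))
    exact this
  refine ⟨I, hI, n, x, fun m => ?_⟩
  let S := Submodule.span ℤ (Set.range (F.cellVec x (m := m)))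
  let q : F.obj ⟨m⟩ ⟶ AddCommGrpCat.of (F.obj ⟨m⟩ ⧸ S) := AddCommGrpCat.ofHom S.mkQ.toAddMonoidHom
  have hq : φ.app ⟨m⟩ ≫ q = 0 := by
    refine (isColimitOfPreserves ((evaluation FI AddCommGrpCat.{u}).obj ⟨m⟩)
      (coproductIsCoproduct fun i => principal.{u} (n i))).hom_ext fun ⟨i⟩ => ?_
    rw [comp_zero]
    change ((Sigma.ι (fun i => principal.{u} (n i)) i).app ⟨m⟩) ≫ φ.app ⟨m⟩ ≫ q = 0
    rw [← Category.assoc, ← NatTrans.comp_app]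
    refine AddCommGrpCat.hom_ext (FreeAbelianGroup.lift_ext _ _ fun ⟨g⟩ => ?_)
    change q ((ψ i).app ⟨m⟩ (FreeAbelianGroup.of (ULift.up (FI.homOfEmb g)))) = 0
    rw [hψ]
    exact (Submodule.Quotient.mk_eq_zero S).2 (Submodule.subset_span ⟨⟨i, g⟩, rfl⟩)
  rw [eq_top_iff]
  intro y _
  obtain ⟨w, rfl⟩ := hφ ⟨m⟩ y
  exact (Submodule.Quotient.mk_eq_zero S).1 (ConcreteCategory.congr_hom hq w)

end FIModule

theorem mainTheorem6 (F : FIModule.{u}) (hF : F.IsFinitelyGenerated) : F.HasFiniteDegree := by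
  obtain ⟨I, _, n, x, hx⟩ := hF.exists_generates
  obtain ⟨B, hB⟩ := (Set.finite_range n).bddAbove
  refine ⟨((B + 1 : ℕ) : ℤ) - 1, by omega, hx.hasDegree (B + 1) fun i => ?_⟩
  exact Nat.lt_succ_of_le (hB ⟨i, rfl⟩)
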